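/- A skew brace is a set $E$ with two group structures $(E,+)$ and $(E,\circ)$ (neither assumed commutative) such that $a\circ(b+c)=(a\circ b)-a+(a\circ c)$ for all $a,b,c\in E$; put $\lambda_a(b)=-a+(a\circ b)$. A sub-skew brace is a subset that is a subgroup of both groups. An ideal is a subgroup of $(E,+)$ that is mapped into itself by every $\lambda_a$ and is normal in both $(E,+)$ and $(E,\circ)$. A finite skew brace $E$ is soluble if it has a series of ideals $\{0\}=I_0\subseteq I_1\subseteq\cdots\subseteq I_n=E$ such that in each quotient skew brace $I_i/I_{i-1}$ the two operations coincide and are commutative. For a set $\pi$ of primes, a sub-skew brace $K$ of a finite skew brace $E$ is a Hall $\pi$-sub-skew brace if every prime divisor of $|K|$ lies in $\pi$ and no prime divisor of $|E|/|K|$ lies in $\pi$; a Sylow $p$-sub-skew brace is a Hall $\{p\}$-sub-skew brace. **Theorem.** Let $E$ be a finite soluble skew brace such that $\lambda_x(y)$ commutes with $y$ in $(E,+)$ for all $x,y\in E$. Then $E$ has a Hall $\pi$-sub-skew brace for every subset $\pi$ of the set of prime divisors of $|E|$. In particular, $E$ has a Sylow $p$-sub-skew brace for every prime divisor $p$ of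 $|E|$. -/

import Mathlib

/-- A skew (left) brace: a type with two group structures `(A, +)` and `(A, *)`, where `*` is
the operation usually written `∘` and `+` need not be commutative, such that
`a ∘ (b + c) = (a ∘ b) - a + (a ∘ c)`. -/
class SkewBrace (A : Type*) extends AddGroup A, Group A where
  mul_add_compat : ∀ a b c : A, a * (b + c) = a * b - a + a * c

namespace SkewBrace

variable {A : Type*} [SkewBrace A]

/-- The map `λ_a(b) = -a + (a ∘ b)`. -/
def lam (a b : A) : A := -a + a * b

theorem mul_eq (a b : A) : a * b = a + lam a b := by simp [lam]

theorem mul_zero_eq (a : A) : a * 0 = a := by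
  have h := mul_add_compat a 0 0
  rw [add_zero, sub_eq_add_neg, add_assoc, left_eq_add, neg_add_eq_zero] at h
  exact h.symm

theorem zero_eq_one : (0 : A) = 1 := by
  have h := mul_zero_eq (1 : A)
  rwa [one_mul] at h

theorem lam_add (a b c : A) : lam a (b + c) = lam a b + lam a c := by
  simp [lam, mul_add_compat, sub_eq_add_neg, add_assoc]

theorem lam_zero (a : A) : lam a 0 = 0 := by simp [lam, mul_zero_eq]

theorem lam_neg (a b : A) : lam a (-b) = -lam a b := by
  rw [eq_neg_iff_add_eq_zero, ← lam_add, neg_add_cancel, lam_zero]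

theorem lam_one (b : A) : lam 1 b = b := by simp [lam, ← zero_eq_one (A := A)]

theorem lam_mul (a b c : A) : lam (a * b) c = lam a (lam b c) := by
  have h : lam a (lam b c) = -lam a b + lam a (b * c) := by
    rw [← lam_neg, ← lam_add]; rfl
  rw [h]; simp [lam, mul_assoc, add_assoc]

theorem lam_inv_mul (a b : A) : lam a (a⁻¹ * b) = -a + b := by simp [lam]

theorem lam_inv_lam (a b : A) : lam a⁻¹ (lam a b) = b := by
  rw [← lam_mul, inv_mul_cancel, lam_one]

/-- A trivial skew brace of abelian type: both operations coincide and are commutative. -/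
def IsTrivialOfAbelianType (A : Type*) [SkewBrace A] : Prop :=
  (∀ a b : A, a * b = a + b) ∧ ∀ a b : A, a + b = b + a

end SkewBrace

/-- A sub-skew brace: a subset which is a subgroup of both group structures. -/
structure SubSkewBrace (A : Type*) [SkewBrace A] extends AddSubgroup A, Subgroup A

namespace SubSkewBrace

variable {A : Type*} [SkewBrace A]

instance : SetLike (SubSkewBrace A) A where
  coe K := K.carrier
  coe_injective := by
    rintro ⟨⟨⟨⟨_, _⟩, _⟩, _⟩, _, _, _⟩ ⟨⟨⟨⟨_, _⟩, _⟩, _⟩, _, _, _⟩ h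
    cases h
    rfl

instance (K : SubSkewBrace A) : SkewBrace K where
  toAddGroup := inferInstanceAs (AddGroup K.toAddSubgroup)
  toGroup := inferInstanceAs (Group K.toSubgroup)
  mul_add_compat a b c := Subtype.ext (SkewBrace.mul_add_compat (a : A) b c)

end SubSkewBrace

/-- An ideal of a skew brace: an additive subgroup which is stable under all the maps `λ_a` and
is normal in both group structures. -/
structure SkewBraceIdeal (A : Type*) [SkewBrace A] extends AddSubgroup A where
  lam_mem : ∀ (a : A) {c : A}, c ∈ carrier → SkewBrace.lam a c ∈ carrier
  add_conj_mem : ∀ (a : A) {c : A}, c ∈ carrier → a + c + -a ∈ carrier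
  mul_conj_mem : ∀ (a : A) {c : A}, c ∈ carrier → a * c * a⁻¹ ∈ carrier

namespace SkewBraceIdeal

open SkewBrace

variable {A : Type*} [SkewBrace A]

instance : SetLike (SkewBraceIdeal A) A where
  coe I := I.carrier
  coe_injective := by
    rintro ⟨⟨⟨⟨_, _⟩, _⟩, _⟩, _, _, _⟩ ⟨⟨⟨⟨_, _⟩, _⟩, _⟩, _, _, _⟩ h
    cases h
    rfl

instance (I : SkewBraceIdeal A) : I.toAddSubgroup.Normal :=
  ⟨fun _ hc a => I.add_conj_mem a hc⟩

theorem neg_add_mem_iff (I : SkewBraceIdeal A) (a b : A) :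
    -a + b ∈ I.toAddSubgroup ↔ a⁻¹ * b ∈ I.toAddSubgroup := by
  rw [← lam_inv_mul]
  refine ⟨fun h => ?_, fun h => I.lam_mem a h⟩
  have := I.lam_mem a⁻¹ h
  rwa [lam_inv_lam] at this

theorem mul_mem (I : SkewBraceIdeal A) {a b : A} (ha : a ∈ I.toAddSubgroup)
    (hb : b ∈ I.toAddSubgroup) : a * b ∈ I.toAddSubgroup := by
  rw [mul_eq]
  exact I.toAddSubgroup.add_mem ha (I.lam_mem a hb)

theorem inv_mem (I : SkewBraceIdeal A) {a : A} (ha : a ∈ I.toAddSubgroup) :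
    a⁻¹ ∈ I.toAddSubgroup := by
  have h := (I.neg_add_mem_iff a 0).1 (by simpa using ha)
  rwa [mul_zero_eq] at h

/-- An ideal, regarded as a sub-skew brace. -/
def toSubSkewBrace (I : SkewBraceIdeal A) : SubSkewBrace A where
  toAddSubgroup := I.toAddSubgroup
  mul_mem' := I.mul_mem
  one_mem' := by
    have h := I.toAddSubgroup.zero_mem
    rwa [zero_eq_one] at h
  inv_mem' := I.inv_mem

/-- The ideal `I ∩ K` of a sub-skew brace `K`; this is `I` itself as an ideal of `K`
when `I ⊆ K`. -/
def restrict (I : SkewBraceIdeal A) (K : SubSkewBrace A) : SkewBraceIdeal K where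
  carrier := {x | (x : A) ∈ I.carrier}
  add_mem' ha hb := I.add_mem' ha hb
  zero_mem' := I.zero_mem'
  neg_mem' ha := I.neg_mem' ha
  lam_mem a _ hc := I.lam_mem (a : A) hc
  add_conj_mem a _ hc := I.add_conj_mem (a : A) hc
  mul_conj_mem a _ hc := I.mul_conj_mem (a : A) hc

/-- The underlying type of the quotient skew brace `A / I`. -/
def Quot (I : SkewBraceIdeal A) : Type _ := A ⧸ I.toAddSubgroup

/-- The projection `A → A / I`. -/
def proj (I : SkewBraceIdeal A) (a : A) : I.Quot := (QuotientAddGroup.mk a : A ⧸ I.toAddSubgroup)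

theorem proj_eq_iff (I : SkewBraceIdeal A) {a b : A} :
    I.proj a = I.proj b ↔ -a + b ∈ I.toAddSubgroup :=
  QuotientAddGroup.eq

theorem proj_surjective (I : SkewBraceIdeal A) : Function.Surjective I.proj :=
  QuotientAddGroup.mk_surjective

theorem proj_mul_congr (I : SkewBraceIdeal A) {a a' b b' : A} (ha : I.proj a = I.proj a')
    (hb : I.proj b = I.proj b') : I.proj (a * b) = I.proj (a' * b') := by
  rw [proj_eq_iff, neg_add_mem_iff] at *
  have h1 := I.mul_mem (I.mul_conj_mem b⁻¹ ha) hb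
  simpa [mul_assoc] using h1

theorem proj_inv_congr (I : SkewBraceIdeal A) {a a' : A} (ha : I.proj a = I.proj a') :
    I.proj a⁻¹ = I.proj a'⁻¹ := by
  rw [proj_eq_iff, neg_add_mem_iff] at *
  have h1 := I.inv_mem (I.mul_conj_mem a ha)
  simpa [mul_assoc] using h1

instance (I : SkewBraceIdeal A) : AddGroup I.Quot :=
  inferInstanceAs (AddGroup (A ⧸ I.toAddSubgroup))

instance (I : SkewBraceIdeal A) : Mul I.Quot where
  mul := Quotient.lift₂ (fun a b => I.proj (a * b)) fun _ _ _ _ h1 h2 =>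
    I.proj_mul_congr (Quotient.sound h1) (Quotient.sound h2)

instance (I : SkewBraceIdeal A) : Inv I.Quot where
  inv := Quotient.lift (fun a => I.proj a⁻¹) fun _ _ h => I.proj_inv_congr (Quotient.sound h)

instance (I : SkewBraceIdeal A) : One I.Quot where
  one := I.proj 1

theorem proj_add (I : SkewBraceIdeal A) (a b : A) : I.proj (a + b) = I.proj a + I.proj b := rfl

theorem proj_neg (I : SkewBraceIdeal A) (a : A) : I.proj (-a) = -I.proj a := rfl

theorem proj_mul (I : SkewBraceIdeal A) (a b : A) : I.proj (a * b) = I.proj a * I.proj b := rfl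

theorem proj_inv (I : SkewBraceIdeal A) (a : A) : I.proj a⁻¹ = (I.proj a)⁻¹ := rfl

theorem proj_one (I : SkewBraceIdeal A) : I.proj 1 = 1 := rfl

instance (I : SkewBraceIdeal A) : Group I.Quot :=
  Group.ofLeftAxioms
    (by
      intro x y z
      obtain ⟨a, rfl⟩ := I.proj_surjective x
      obtain ⟨b, rfl⟩ := I.proj_surjective y
      obtain ⟨c, rfl⟩ := I.proj_surjective z
      simp only [← proj_mul, mul_assoc])
    (by
      intro x
      obtain ⟨a, rfl⟩ := I.proj_surjective x
      rw [← proj_one, ← proj_mul, one_mul])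
    (by
      intro x
      obtain ⟨a, rfl⟩ := I.proj_surjective x
      rw [← proj_inv, ← proj_mul, inv_mul_cancel, proj_one])

/-- The quotient skew brace `A / I`: both operations are induced from `A`. -/
instance (I : SkewBraceIdeal A) : SkewBrace I.Quot where
  mul_add_compat x y z := by
    obtain ⟨a, rfl⟩ := I.proj_surjective x
    obtain ⟨b, rfl⟩ := I.proj_surjective y
    obtain ⟨c, rfl⟩ := I.proj_surjective z
    rw [← proj_add, ← proj_mul, mul_add_compat, sub_eq_add_neg, sub_eq_add_neg]
    rfl

end SkewBraceIdeal

namespace SkewBrace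

/-- A skew brace is soluble if it has a finite series of ideals
`{0} = I 0 ⊆ I 1 ⊆ ⋯ ⊆ I n = A` such that every quotient skew brace `I (i + 1) / I i` is trivial
of abelian type. -/
def IsSoluble (A : Type*) [SkewBrace A] : Prop :=
  ∃ (n : ℕ) (I : ℕ → SkewBraceIdeal A),
    (I 0 : Set A) = {0} ∧ (I n : Set A) = Set.univ ∧
    ∀ i < n, (I i : Set A) ⊆ I (i + 1) ∧
      IsTrivialOfAbelianType ((I i).restrict (I (i + 1)).toSubSkewBrace).Quot

end SkewBrace

namespace SubSkewBrace

variable {A : Type*} [SkewBrace A]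

/-- `K` is a Hall `π`-sub-skew brace: every prime divisor of the order of `K` lies in `π`, and no
prime divisor of the index of `K` lies in `π`. -/
def IsHall (π : Set ℕ) (K : SubSkewBrace A) : Prop :=
  (∀ p : ℕ, p.Prime → p ∣ Nat.card K → p ∈ π) ∧
    ∀ p : ℕ, p.Prime → p ∣ K.toAddSubgroup.index → p ∉ π

/-- A Sylow `p`-sub-skew brace is a Hall `{p}`-sub-skew brace. -/
def IsSylow (p : ℕ) (K : SubSkewBrace A) : Prop := K.IsHall {p}

end SubSkewBrace

/-! Induction on |E|. Solubility gives a nonzero ideal J that is a trivial brace and an abelian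
p-group; let H be a Hall π-sub-skew brace of E/J and L its preimage. If p ∈ π, L itself is Hall.
Otherwise |J| is coprime to its index in L, and a complement of J in L is needed
(`exists_complement`).

An additive complement exists by Schur-Zassenhaus, but it must also be λ-invariant. The commuting
hypothesis together with coprimality puts J in the kernel of λ (`lam_eq_of_mem`), so λ factors
through a group of order coprime to |J|. As in Maschke's theorem, the derivation projecting onto J
is averaged over this group; the kernel of the average is a λ-invariant complement, hence a sub-skew
brace. -/

theorem AddSubgroup.exists_isComplement'_of_coprime {A : Type*} [AddGroup A] (N : AddSubgroup A)
    [hN : N.Normal] (h : Nat.Coprime (Nat.card N) N.index) :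
    ∃ K : AddSubgroup A, AddSubgroup.IsComplement' N K := by
  have hN' : (AddSubgroup.toSubgroup N).Normal := ⟨fun n hn g => hN.conj_mem n hn g⟩
  obtain ⟨K, hK⟩ := Subgroup.exists_right_complement'_of_coprime
    (N := AddSubgroup.toSubgroup N) h
  exact ⟨AddSubgroup.toSubgroup.symm K, hK⟩

/-! ### Complements of abelian ideals of coprime index -/

namespace SkewBraceIdeal

open SkewBrace

variable {E : Type*} [SkewBrace E] (J : SkewBraceIdeal E)

instance : J.toSubSkewBrace.toSubgroup.Normal :=
  ⟨fun _ hc a => J.mul_conj_mem a hc⟩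

/-- Additive conjugation by `a`, restricted to an ideal. -/
def conjHom (a : E) : J.toAddSubgroup →+ J.toAddSubgroup where
  toFun x := ⟨a + x + -a, J.add_conj_mem a x.2⟩
  map_zero' := by simp
  map_add' x y := Subtype.ext (by simp [add_assoc])

/-- The map `λ_a`, restricted to an ideal. -/
def lamHom (a : E) : J.toAddSubgroup →+ J.toAddSubgroup where
  toFun x := ⟨lam a x, J.lam_mem a x.2⟩
  map_zero' := Subtype.ext (lam_zero a)
  map_add' x y := Subtype.ext (lam_add a x y)

theorem conjHom_add (a b : E) (m : J.toAddSubgroup) :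
    J.conjHom (a + b) m = J.conjHom a (J.conjHom b m) :=
  Subtype.ext (by simp [conjHom, add_assoc])

theorem lamHom_mul (a b : E) (m : J.toAddSubgroup) :
    J.lamHom (a * b) m = J.lamHom a (J.lamHom b m) :=
  Subtype.ext (lam_mul a b m)

/-- This compatibility makes the twist of a derivation by some λ_q again a derivation. -/
theorem lamHom_conjHom (a b : E) (m : J.toAddSubgroup) :
    J.lamHom a (J.conjHom b m) = J.conjHom (lam a b) (J.lamHom a m) :=
  Subtype.ext (by simp [lamHom, conjHom, lam_add, lam_neg])

/-- The elements of an ideal `J` act trivially modulo `J`. -/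
theorem neg_add_lam_mem {x : E} (hx : x ∈ J.toAddSubgroup) (y : E) :
    -y + lam x y ∈ J.toAddSubgroup := by
  rw [← proj_eq_iff, lam, proj_add, proj_neg, proj_mul]
  have h : J.proj x = 0 := by
    rw [eq_comm]
    exact J.proj_eq_iff.2 (by simpa using hx)
  have h0 : J.proj x * J.proj y = J.proj y := by
    rw [h, zero_eq_one, one_mul]
  rw [h0, h, neg_zero, zero_add]

/-- If the ideal `J` is a trivial skew brace of abelian type, of order coprime to its index, and
`λ_x(y)` always commutes with `y`, then `J` is contained in the kernel of `λ`. -/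
theorem lam_eq_of_mem [Finite E] (hcomm : ∀ x y : E, AddCommute (lam x y) y)
    (hmul : ∀ a ∈ J.toAddSubgroup, ∀ b ∈ J.toAddSubgroup, a * b = a + b)
    (hco : Nat.Coprime (Nat.card J.toAddSubgroup) J.toAddSubgroup.index)
    {x : E} (hx : x ∈ J.toAddSubgroup) (y : E) : lam x y = y := by
  obtain ⟨K, hK⟩ := AddSubgroup.exists_isComplement'_of_coprime J.toAddSubgroup hco
  have key : ∀ k ∈ K, lam x k = k := by
    intro k hk
    have hn : J.toAddSubgroup.index • k = 0 := by
      rw [← hK.card_right]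
      exact congrArg Subtype.val (card_nsmul_eq_zero' (x := (⟨k, hk⟩ : K)))
    have hn' : J.toAddSubgroup.index • lam x k = 0 := by
      have := map_nsmul (⟨⟨lam x, lam_zero x⟩, lam_add x⟩ : E →+ E) J.toAddSubgroup.index k
      rw [hn, map_zero] at this
      exact this.symm
    -- Commutation lets the multiple be distributed over the sum; the element also lies in J, so its
    -- order divides two coprime numbers.
    have h1 : J.toAddSubgroup.index • (-k + lam x k) = 0 := by
      rw [AddCommute.add_nsmul (hcomm x k).symm.neg_left, neg_nsmul, hn, hn']
      simp
    have h2 : Nat.card J.toAddSubgroup • (-k + lam x k) = 0 :=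
      congrArg Subtype.val (card_nsmul_eq_zero'
        (x := (⟨_, J.neg_add_lam_mem hx k⟩ : J.toAddSubgroup)))
    have h3 := Nat.dvd_gcd (addOrderOf_dvd_of_nsmul_eq_zero h2)
      (addOrderOf_dvd_of_nsmul_eq_zero h1)
    rw [hco.gcd_eq_one, Nat.dvd_one, AddMonoid.addOrderOf_eq_one_iff] at h3
    exact (neg_add_eq_zero.1 h3).symm
  obtain ⟨⟨j, k⟩, rfl⟩ := hK.2 y
  change lam x ((j : E) + k) = j + k
  rw [lam_add, key _ k.2]
  congr 1
  rw [lam, hmul _ hx _ j.2, neg_add_cancel_left]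

/-- A Schur-Zassenhaus theorem: an ideal that is a trivial skew brace of abelian type, of order
coprime to its index, is complemented by a sub-skew brace. -/
theorem exists_complement [Finite E] (hcomm : ∀ x y : E, AddCommute (lam x y) y)
    (hmul : ∀ a ∈ J.toAddSubgroup, ∀ b ∈ J.toAddSubgroup, a * b = a + b)
    (hadd : ∀ a ∈ J.toAddSubgroup, ∀ b ∈ J.toAddSubgroup, a + b = b + a)
    (hco : Nat.Coprime (Nat.card J.toAddSubgroup) J.toAddSubgroup.index) :
    ∃ K : SubSkewBrace E, AddSubgroup.IsComplement' J.toAddSubgroup K.toAddSubgroup := by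
  let _ : AddCommGroup J.toAddSubgroup :=
    { (inferInstance : AddGroup J.toAddSubgroup) with
      add_comm := fun a b => Subtype.ext (hadd a a.2 b b.2) }
  obtain ⟨K₀, hK₀⟩ := AddSubgroup.exists_isComplement'_of_coprime J.toAddSubgroup hco
  -- Q complements J in the multiplicative group. As J acts trivially, Q realises every λ_x.
  obtain ⟨Q, hQ⟩ : ∃ Q : Subgroup E, Subgroup.IsComplement' Q J.toSubSkewBrace.toSubgroup := by
    apply Subgroup.exists_left_complement'_of_coprime
    have h1 := J.toSubSkewBrace.toSubgroup.card_mul_index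
    rw [← J.toAddSubgroup.card_mul_index] at h1
    have h2 := Nat.eq_of_mul_eq_mul_left (Nat.card_pos (α := J.toAddSubgroup)) h1
    rw [h2]
    exact hco
  have hQcard : Nat.card Q = J.toAddSubgroup.index := by
    have h1 := hQ.card_mul_card
    rw [← J.toAddSubgroup.card_mul_index, mul_comm] at h1
    exact Nat.eq_of_mul_eq_mul_left (Nat.card_pos (α := J.toAddSubgroup)) h1
  have hlam : ∀ x : E, ∃ q ∈ Q, lam x = lam q := by
    intro x
    obtain ⟨⟨q, j⟩, rfl⟩ := hQ.2 x
    refine ⟨q, q.2, funext fun y => ?_⟩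
    change lam ((q : E) * j) y = _
    rw [lam_mul, J.lam_eq_of_mem hcomm hmul hco j.2]
  have hconj : ∀ (j m : J.toAddSubgroup), J.conjHom j m = m := fun j m =>
    Subtype.ext (by
      change (j : E) + m + -j = m
      rw [hadd j j.2 m m.2, add_neg_cancel_right])
  -- the projection onto `J` along `K₀` is a derivation
  choose ρ hρ using fun e : E => show ∃ m : J.toAddSubgroup, -(m : E) + e ∈ K₀ by
    obtain ⟨⟨j, k⟩, rfl⟩ := hK₀.2 e
    exact ⟨j, by simp⟩
  have hdisj : ∀ m : J.toAddSubgroup, (m : E) ∈ K₀ → m = 0 := fun m hm =>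
    congrArg Prod.fst (@hK₀.1 (m, (0 : K₀)) ((0 : J.toAddSubgroup), ⟨m, hm⟩) (by simp))
  have huniq : ∀ (e : E) (m : J.toAddSubgroup), -(m : E) + e ∈ K₀ → ρ e = m := by
    intro e m hm
    have h := K₀.add_mem hm (K₀.neg_mem (hρ e))
    rw [neg_add_rev, neg_neg, add_assoc, add_neg_cancel_left] at h
    exact (neg_add_eq_zero.1 (hdisj (-m + ρ e) h)).symm
  have hρadd : ∀ a b : E, ρ (a + b) = ρ a + J.conjHom a (ρ b) := by
    intro a b
    apply huniq
    -- Since J is abelian, a may be replaced by its K₀-component.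
    have h : J.conjHom a (ρ b) = J.conjHom (-(ρ a : E) + a) (ρ b) := by
      rw [conjHom_add]
      exact (hconj (-ρ a) _).symm
    rw [h]
    have := K₀.add_mem (hρ a) (hρ b)
    convert this using 1
    simp [conjHom, add_assoc]
  have hρid : ∀ m : J.toAddSubgroup, ρ m = m := fun m => huniq _ _ (by simp)
  let _ := Fintype.ofFinite Q
  -- The average of ρ over Q, left undivided: on J it is multiplication by |Q|, which is bijective
  -- by coprimality.
  let σ : E → J.toAddSubgroup := fun e => ∑ q : Q, J.lamHom q (ρ (lam (q : E)⁻¹ e))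
  have lam_lam_inv : ∀ a b : E, lam a (lam a⁻¹ b) = b := fun a b => by
    rw [← lam_mul, mul_inv_cancel, lam_one]
  have hσadd : ∀ a b : E, σ (a + b) = σ a + J.conjHom a (σ b) := by
    intro a b
    simp only [σ, map_sum, ← Finset.sum_add_distrib]
    refine Finset.sum_congr rfl fun q _ => ?_
    rw [lam_add, hρadd, map_add, lamHom_conjHom, lam_lam_inv]
  have hσid : ∀ m : J.toAddSubgroup, σ m = J.toAddSubgroup.index • m := by
    intro m
    rw [← hQcard, Nat.card_eq_fintype_card, ← Finset.card_univ, ← Finset.sum_const]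
    refine Finset.sum_congr rfl fun q _ => ?_
    have h : lam (q : E)⁻¹ (m : E) = (J.lamHom (q : E)⁻¹ m : J.toAddSubgroup) := rfl
    rw [h, hρid, ← lamHom_mul, mul_inv_cancel]
    exact Subtype.ext (lam_one _)
  have hσlam : ∀ (r : Q) (e : E), σ (lam r e) = J.lamHom r (σ e) := by
    intro r e
    simp only [σ, map_sum]
    -- Reindexing by q ↦ rq cancels r inside the argument.
    rw [← Equiv.sum_comp (Equiv.mulLeft r)]
    refine Finset.sum_congr rfl fun q _ => ?_
    rw [← lamHom_mul, ← lam_mul]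
    simp
  have hσzero : σ 0 = 0 := by
    have := hσid 0
    rwa [smul_zero] at this
  let K₁ : AddSubgroup E :=
    { carrier := {e | σ e = 0}
      zero_mem' := hσzero
      add_mem' := fun {a b} (ha : σ a = 0) (hb : σ b = 0) => by
        change σ (a + b) = 0
        rw [hσadd, ha, hb, map_zero, add_zero]
      neg_mem' := fun {a} (ha : σ a = 0) => by
        change σ (-a) = 0
        have h := hσadd (-a) a
        rwa [ha, map_zero, add_zero, neg_add_cancel, hσzero, eq_comm] at h }
  have hK₁lam : ∀ (x : E) {e : E}, e ∈ K₁ → lam x e ∈ K₁ := by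
    intro x e (he : σ e = 0)
    obtain ⟨q, hq, h⟩ := hlam x
    change σ (lam x e) = 0
    rw [h, hσlam ⟨q, hq⟩, he, map_zero]
  refine ⟨{ K₁ with
    mul_mem' := fun {a b} ha hb => ?_
    one_mem' := ?_
    inv_mem' := fun {a} ha => ?_ }, ?_⟩
  · rw [mul_eq]
    exact K₁.add_mem ha (hK₁lam a hb)
  · change (1 : E) ∈ K₁
    rw [← zero_eq_one]
    exact K₁.zero_mem
  · have h : lam a⁻¹ (-a) = a⁻¹ := by
      have h1 := mul_eq a⁻¹ a
      rw [inv_mul_cancel, ← zero_eq_one] at h1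
      rw [lam_neg]
      exact (eq_neg_of_add_eq_zero_left h1.symm).symm
    change a⁻¹ ∈ K₁
    rw [← h]
    exact hK₁lam _ (K₁.neg_mem ha)
  · change AddSubgroup.IsComplement' J.toAddSubgroup K₁
    have hdisj₁ : ∀ m : J.toAddSubgroup, (m : E) ∈ K₁ → m = 0 := by
      intro m (hm : σ m = 0)
      rw [hσid] at hm
      have h := Nat.dvd_gcd (addOrderOf_dvd_natCard m) (addOrderOf_dvd_of_nsmul_eq_zero hm)
      rwa [hco.gcd_eq_one, Nat.dvd_one, AddMonoid.addOrderOf_eq_one_iff] at h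
    constructor
    · rintro ⟨j, k⟩ ⟨j', k'⟩ (h : (j : E) + k = j' + k')
      have h1 : -(j' : E) + j = k' + -k := by
        rw [eq_add_neg_iff_add_eq, add_assoc, h, neg_add_cancel_left]
      have h2 : -j' + j = 0 :=
        hdisj₁ (-j' + j) (by
          change -(j' : E) + j ∈ K₁
          rw [h1]
          exact K₁.add_mem k'.2 (K₁.neg_mem k.2))
      obtain rfl : j' = j := neg_add_eq_zero.1 h2
      exact Prod.ext rfl (Subtype.ext (add_left_cancel h))
    · intro e
      -- Dividing σ(e) by the index gives the J-component of e.
      obtain ⟨j, hj⟩ := (nsmulCoprime hco).surjective (σ e)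
      refine ⟨(j, ⟨-j + e, ?_⟩), by simp⟩
      change σ (-j + e) = 0
      have h := hσadd ((-j : J.toAddSubgroup) : E) e
      rw [hconj, hσid, ← hj] at h
      refine h.trans ?_
      simp

end SkewBraceIdeal

/-! ### Passage to quotients and sub-skew braces; torsion ideals -/

namespace SkewBraceIdeal

open SkewBrace

variable {E : Type*} [SkewBrace E] (J : SkewBraceIdeal E)

/-- The image of an ideal in a quotient. -/
def mapProj (I : SkewBraceIdeal E) : SkewBraceIdeal J.Quot where
  carrier := J.proj '' I
  zero_mem' := ⟨0, I.zero_mem', rfl⟩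
  add_mem' := by
    rintro _ _ ⟨a, ha, rfl⟩ ⟨b, hb, rfl⟩
    exact ⟨a + b, I.add_mem' ha hb, rfl⟩
  neg_mem' := by
    rintro _ ⟨a, ha, rfl⟩
    exact ⟨-a, I.neg_mem' ha, rfl⟩
  lam_mem := by
    rintro x _ ⟨c, hc, rfl⟩
    obtain ⟨a, rfl⟩ := J.proj_surjective x
    exact ⟨lam a c, I.lam_mem a hc, rfl⟩
  add_conj_mem := by
    rintro x _ ⟨c, hc, rfl⟩
    obtain ⟨a, rfl⟩ := J.proj_surjective x
    exact ⟨a + c + -a, I.add_conj_mem a hc, rfl⟩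
  mul_conj_mem := by
    rintro x _ ⟨c, hc, rfl⟩
    obtain ⟨a, rfl⟩ := J.proj_surjective x
    exact ⟨a * c * a⁻¹, I.mul_conj_mem a hc, rfl⟩

/-- The preimage of a sub-skew brace under the projection to a quotient. -/
def comapProj (H : SubSkewBrace J.Quot) : SubSkewBrace E where
  carrier := J.proj ⁻¹' H
  zero_mem' := H.zero_mem'
  add_mem' ha hb := H.add_mem' ha hb
  neg_mem' ha := H.neg_mem' ha
  one_mem' := H.one_mem'
  mul_mem' ha hb := H.mul_mem' ha hb
  inv_mem' ha := H.inv_mem' ha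

theorem index_comapProj (H : SubSkewBrace J.Quot) :
    (J.comapProj H).toAddSubgroup.index = H.toAddSubgroup.index :=
  AddSubgroup.index_comap_of_surjective H.toAddSubgroup
    (f := (⟨⟨J.proj, rfl⟩, fun _ _ => rfl⟩ : E →+ J.Quot)) J.proj_surjective

theorem card_comapProj [Finite E] (H : SubSkewBrace J.Quot) :
    Nat.card (J.comapProj H) = Nat.card J.toAddSubgroup * Nat.card H := by
  have h1 := (J.comapProj H).toAddSubgroup.card_mul_index
  have h2 : Nat.card H * H.toAddSubgroup.index = J.toAddSubgroup.index :=
    H.toAddSubgroup.card_mul_index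
  have : Finite J.Quot := Finite.of_surjective _ J.proj_surjective
  rw [← J.toAddSubgroup.card_mul_index, index_comapProj, ← h2, ← mul_assoc] at h1
  exact Nat.eq_of_mul_eq_mul_right (Nat.pos_of_ne_zero AddSubgroup.index_ne_zero_of_finite) h1

theorem le_comapProj (H : SubSkewBrace J.Quot) {x : E} (hx : x ∈ J.toAddSubgroup) :
    x ∈ J.comapProj H := by
  have h : J.proj 0 = J.proj x := J.proj_eq_iff.2 (by simpa using hx)
  change J.proj x ∈ H.toAddSubgroup
  rw [← h]
  exact H.zero_mem'

/-- The elements of an ideal killed by `p` form an ideal, if the given ideal is a trivial skew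
brace of abelian type. -/
def torsion (I : SkewBraceIdeal E)
    (hI : ∀ a ∈ I, ∀ b ∈ I, a * b = a + b ∧ a + b = b + a) (p : ℕ) : SkewBraceIdeal E where
  carrier := {x | x ∈ I ∧ p • x = 0}
  zero_mem' := ⟨I.zero_mem', smul_zero p⟩
  add_mem' {a b} ha hb := ⟨I.add_mem' ha.1 hb.1, by
    rw [AddCommute.add_nsmul (hI a ha.1 b hb.1).2, ha.2, hb.2, add_zero]⟩
  neg_mem' ha := ⟨I.neg_mem' ha.1, by rw [neg_nsmul, ha.2, neg_zero]⟩
  lam_mem a c hc := ⟨I.lam_mem a hc.1, by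
    have := map_nsmul (⟨⟨lam a, lam_zero a⟩, lam_add a⟩ : E →+ E) p c
    rw [hc.2, map_zero] at this
    exact this.symm⟩
  add_conj_mem a c hc := ⟨I.add_conj_mem a hc.1, by
    have := map_nsmul (AddAut.addConj a) p c
    rw [hc.2, map_zero] at this
    exact this.symm⟩
  mul_conj_mem a c hc := ⟨I.mul_conj_mem a hc.1, by
    -- Multiplicative conjugation preserves powers, and within I these are the additive multiples.
    have key : ∀ x ∈ I, ∀ n : ℕ, x ^ n = n • x := by
      intro x hx n
      induction n with
      | zero => rw [pow_zero, zero_nsmul, zero_eq_one]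
      | succ n ih =>
        rw [pow_succ, succ_nsmul, ih]
        exact (hI _ (I.toAddSubgroup.nsmul_mem hx n) _ hx).1
    rw [← key _ (I.mul_conj_mem a hc.1), conj_pow, key c hc.1, hc.2, zero_eq_one, mul_one,
      mul_inv_cancel]⟩

end SkewBraceIdeal

namespace SubSkewBrace

variable {E : Type*} [SkewBrace E]

/-- A sub-skew brace of a sub-skew brace, regarded as a sub-skew brace of the whole. -/
def mapSubtype (H : SubSkewBrace E) (K : SubSkewBrace H) : SubSkewBrace E where
  carrier := Subtype.val '' (K : Set H)
  zero_mem' := ⟨0, K.zero_mem', rfl⟩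
  add_mem' := by
    rintro _ _ ⟨a, ha, rfl⟩ ⟨b, hb, rfl⟩
    exact ⟨a + b, K.add_mem' ha hb, rfl⟩
  neg_mem' := by
    rintro _ ⟨a, ha, rfl⟩
    exact ⟨-a, K.neg_mem' ha, rfl⟩
  one_mem' := ⟨1, K.one_mem', rfl⟩
  mul_mem' := by
    rintro _ _ ⟨a, ha, rfl⟩ ⟨b, hb, rfl⟩
    exact ⟨a * b, K.mul_mem' ha hb, rfl⟩
  inv_mem' := by
    rintro _ ⟨a, ha, rfl⟩
    exact ⟨a⁻¹, K.inv_mem' ha, rfl⟩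

theorem card_mapSubtype (H : SubSkewBrace E) (K : SubSkewBrace H) :
    Nat.card (H.mapSubtype K) = Nat.card K :=
  Nat.card_image_of_injective Subtype.val_injective (K : Set H)

end SubSkewBrace

/-! ### Soluble series and the induction -/

namespace SkewBrace

/-- A finite series of ideals, whose factors are trivial skew braces of abelian type, with the
condition on the factors expressed by elements. -/
def HasAbelianSeries (E : Type*) [SkewBrace E] : Prop :=
  ∃ (n : ℕ) (I : ℕ → SkewBraceIdeal E), (I 0 : Set E) = {0} ∧ (I n : Set E) = Set.univ ∧
    ∀ i < n, ∀ a ∈ I (i + 1), ∀ b ∈ I (i + 1),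
      -(a * b) + (a + b) ∈ I i ∧ -(a + b) + (b + a) ∈ I i

variable {E : Type*} [SkewBrace E]

theorem IsSoluble.hasAbelianSeries (h : IsSoluble E) : HasAbelianSeries E := by
  obtain ⟨n, I, h0, hn, h⟩ := h
  refine ⟨n, I, h0, hn, fun i hi a ha b hb => ?_⟩
  obtain ⟨-, hmul, hadd⟩ := h i hi
  let R := (I i).restrict (I (i + 1)).toSubSkewBrace
  let a' : (I (i + 1)).toSubSkewBrace := ⟨a, ha⟩
  let b' : (I (i + 1)).toSubSkewBrace := ⟨b, hb⟩
  exact ⟨R.proj_eq_iff.1 (hmul (R.proj a') (R.proj b')),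
    R.proj_eq_iff.1 (hadd (R.proj a') (R.proj b'))⟩

theorem HasAbelianSeries.quot (h : HasAbelianSeries E) (J : SkewBraceIdeal E) :
    HasAbelianSeries J.Quot := by
  obtain ⟨n, I, h0, hn, h⟩ := h
  refine ⟨n, fun i => J.mapProj (I i), ?_, ?_, ?_⟩
  · change J.proj '' (I 0 : Set E) = _
    rw [h0, Set.image_singleton]
    rfl
  · change J.proj '' (I n : Set E) = _
    rw [hn, Set.image_univ, J.proj_surjective.range_eq]
  · rintro i hi _ ⟨a, ha, rfl⟩ _ ⟨b, hb, rfl⟩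
    exact ⟨⟨_, (h i hi a ha b hb).1, rfl⟩, ⟨_, (h i hi a ha b hb).2, rfl⟩⟩

/-- The first nonzero term of the series works: the term before it is zero, so the congruences
become equalities. -/
theorem HasAbelianSeries.exists_ideal [Nontrivial E] (h : HasAbelianSeries E) :
    ∃ I : SkewBraceIdeal E, (∃ x ∈ I, x ≠ 0) ∧
      ∀ a ∈ I, ∀ b ∈ I, a * b = a + b ∧ a + b = b + a := by
  classical
  obtain ⟨n, I, h0, hn, h⟩ := h
  obtain ⟨y, hy⟩ := exists_ne (0 : E)
  have hex : ∃ i, ∃ x ∈ I i, x ≠ 0 :=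
    ⟨n, y, by rw [← SetLike.mem_coe, hn]; trivial, hy⟩
  have hle : Nat.find hex ≤ n :=
    Nat.find_min' hex ⟨y, by rw [← SetLike.mem_coe, hn]; trivial, hy⟩
  have hspec := Nat.find_spec hex
  have hmin := fun j => Nat.find_min hex (m := j)
  generalize Nat.find hex = k at *
  rcases k with _ | k
  · obtain ⟨x, hx, hx0⟩ := hspec
    rw [← SetLike.mem_coe, h0] at hx
    exact absurd hx hx0
  · have hk : ∀ x ∈ I k, x = 0 := by
      intro x hx
      by_contra hx0
      exact hmin k k.lt_succ_self ⟨x, hx, hx0⟩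
    refine ⟨I (k + 1), hspec, fun a ha b hb => ?_⟩
    have := h k hle a ha b hb
    exact ⟨neg_add_eq_zero.1 (hk _ this.1), neg_add_eq_zero.1 (hk _ this.2)⟩

/-- A nontrivial finite soluble skew brace has a nonzero ideal that is an elementary abelian
`p`-group and a trivial skew brace. -/
theorem HasAbelianSeries.exists_elementary_ideal [Finite E] [Nontrivial E]
    (h : HasAbelianSeries E) :
    ∃ (p : ℕ) (J : SkewBraceIdeal E), p.Prime ∧ p ∣ Nat.card J.toAddSubgroup ∧
      (∀ a ∈ J.toAddSubgroup, ∀ b ∈ J.toAddSubgroup, a * b = a + b ∧ a + b = b + a) ∧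
      ∀ q : ℕ, q.Prime → q ∣ Nat.card J.toAddSubgroup → q = p := by
  obtain ⟨I, ⟨x, hx, hx0⟩, hI⟩ := h.exists_ideal
  let p := (addOrderOf x).minFac
  have hp : p.Prime := Nat.minFac_prime (by simpa using hx0)
  let J := I.torsion hI p
  have hpJ : p ∣ Nat.card J.toAddSubgroup := by
    obtain ⟨k, hk⟩ := (addOrderOf x).minFac_dvd
    have hk0 : k ≠ 0 := by
      rintro rfl
      exact (addOrderOf_pos x).ne' hk
    have hord : addOrderOf (k • x) = p := by
      rw [addOrderOf_nsmul' x hk0, hk, Nat.gcd_mul_left_left, Nat.mul_div_cancel _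
        (Nat.pos_of_ne_zero hk0)]
    have hmem : k • x ∈ J.toAddSubgroup :=
      ⟨I.toAddSubgroup.nsmul_mem hx k, by rw [← hord]; exact addOrderOf_nsmul_eq_zero _⟩
    rw [← hord, ← AddSubgroup.addOrderOf_mk _ hmem]
    exact addOrderOf_dvd_natCard _
  refine ⟨p, J, hp, hpJ, fun a ha b hb => hI a ha.1 b hb.1, fun q hq hqJ => ?_⟩
  have := Fact.mk hq
  obtain ⟨y, hy⟩ := exists_prime_addOrderOf_dvd_card' q hqJ
  have : p • y = 0 := Subtype.ext y.2.2
  rw [← Nat.prime_dvd_prime_iff_eq hq hp, ← hy]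
  exact addOrderOf_dvd_of_nsmul_eq_zero this

/-- Here π is arbitrary, so that the same π serves for the quotient, whose order may have fewer
prime divisors. -/
theorem HasAbelianSeries.exists_isHall [Finite E] (h : HasAbelianSeries E)
    (hcomm : ∀ x y : E, AddCommute (lam x y) y) (π : Set ℕ) :
    ∃ K : SubSkewBrace E, K.IsHall π := by
  induction hn : Nat.card E using Nat.strong_induction_on generalizing E with
  | _ n ih =>
  subst hn
  cases subsingleton_or_nontrivial E with
  | inl hE =>
    let K : SubSkewBrace E := { (⊤ : AddSubgroup E), (⊤ : Subgroup E) with }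
    refine ⟨K, fun p hp hpK => ?_, fun p hp hpK => ?_⟩
    · rw [Nat.card_of_subsingleton (⟨0, K.zero_mem'⟩ : K)] at hpK
      exact absurd hpK hp.not_dvd_one
    · have := K.toAddSubgroup.index_dvd_card
      rw [Nat.card_of_subsingleton (0 : E)] at this
      exact absurd (hpK.trans this) hp.not_dvd_one
  | inr hE =>
    obtain ⟨p, J, hp, hpJ, hJ, hJp⟩ := h.exists_elementary_ideal
    have hfin : Finite J.Quot := Finite.of_surjective _ J.proj_surjective
    have hQcard : Nat.card J.Quot = J.toAddSubgroup.index := rfl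
    have hQlt : Nat.card J.Quot < Nat.card E := by
      rw [hQcard, ← J.toAddSubgroup.card_mul_index]
      exact lt_mul_left (Nat.pos_of_ne_zero AddSubgroup.index_ne_zero_of_finite)
        (hp.one_lt.trans_le (Nat.le_of_dvd Nat.card_pos hpJ))
    have hQcomm : ∀ x y : J.Quot, AddCommute (lam x y) y := by
      intro x y
      obtain ⟨a, rfl⟩ := J.proj_surjective x
      obtain ⟨b, rfl⟩ := J.proj_surjective y
      exact congrArg J.proj (hcomm a b)
    obtain ⟨H, hH, hHi⟩ := ih _ hQlt (h.quot J) hQcomm rfl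
    by_cases hpπ : p ∈ π
    · refine ⟨J.comapProj H, fun q hq hqK => ?_, fun q hq hqK => ?_⟩
      · rw [J.card_comapProj] at hqK
        rcases hq.dvd_mul.1 hqK with h1 | h1
        · rwa [hJp q hq h1]
        · exact hH q hq h1
      · rw [J.index_comapProj] at hqK
        exact hHi q hq hqK
    · let L := J.comapProj H
      let R := J.restrict L
      have hRcard : Nat.card R.toAddSubgroup = Nat.card J.toAddSubgroup :=
        Nat.card_congr ⟨fun x => ⟨x.1.1, x.2⟩,
          fun x => ⟨⟨x.1, J.le_comapProj H x.2⟩, x.2⟩, fun _ => rfl, fun _ => rfl⟩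
      have hRindex : R.toAddSubgroup.index = Nat.card H := by
        have h1 := R.toAddSubgroup.card_mul_index
        rw [hRcard, J.card_comapProj] at h1
        exact Nat.eq_of_mul_eq_mul_left Nat.card_pos h1
      have hco : Nat.Coprime (Nat.card R.toAddSubgroup) R.toAddSubgroup.index := by
        rw [hRcard, hRindex]
        refine Nat.coprime_of_dvd fun q hq h1 h2 => hpπ ?_
        rw [← hJp q hq h1]
        exact hH q hq h2
      obtain ⟨K, hK⟩ := R.exists_complement
        (fun x y => Subtype.ext (hcomm x y))
        (fun a ha b hb => Subtype.ext (hJ a ha b hb).1)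
        (fun a ha b hb => Subtype.ext (hJ a ha b hb).2) hco
      have hKcard : Nat.card (L.mapSubtype K) = Nat.card H := by
        rw [SubSkewBrace.card_mapSubtype, ← hRindex]
        exact hK.card_right
      refine ⟨L.mapSubtype K, fun q hq hqK => hH q hq (hKcard ▸ hqK), fun q hq hqK => ?_⟩
      have h1 : Nat.card (L.mapSubtype K) * (L.mapSubtype K).toAddSubgroup.index = Nat.card E :=
        (L.mapSubtype K).toAddSubgroup.card_mul_index
      have h2 : Nat.card H * H.toAddSubgroup.index = J.toAddSubgroup.index :=
        H.toAddSubgroup.card_mul_index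
      -- Cancelling |H| shows that the complement has index |J| · [E/J : H] in E, and neither factor
      -- has a prime divisor in π.
      rw [hKcard, ← J.toAddSubgroup.card_mul_index, ← h2, mul_left_comm] at h1
      have hHpos : 0 < Nat.card H := (Nat.card_pos (α := H.toAddSubgroup))
      rw [Nat.eq_of_mul_eq_mul_left hHpos h1] at hqK
      rcases hq.dvd_mul.1 hqK with h3 | h3
      · rwa [hJp q hq h3]
      · exact hHi q hq h3

end SkewBrace

theorem mainTheorem9 {E : Type*} [SkewBrace E] [Finite E] (hsol : SkewBrace.IsSoluble E)
    (hcomm : ∀ x y : E, AddCommute (SkewBrace.lam x y) y) :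
    (∀ π : Set ℕ, (∀ p ∈ π, p.Prime ∧ p ∣ Nat.card E) →
      ∃ K : SubSkewBrace E, K.IsHall π) ∧
    (∀ p : ℕ, p.Prime → p ∣ Nat.card E → ∃ K : SubSkewBrace E, K.IsSylow p) :=
  ⟨fun π _ => hsol.hasAbelianSeries.exists_isHall hcomm π,
    fun p _ _ => hsol.hasAbelianSeries.exists_isHall hcomm {p}⟩
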